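/- Let $F$ be a probability distribution on $\mathbb{R}$ (the prior distribution of an asset's value) with support $\{\underline\theta,\overline\theta\}$, where $0\le\underline\theta<\overline\theta<\infty$, and let $\mu$ be its mean. A test-fee structure is a pair $(G,\phi)$, where $G$ is a mean-preserving contraction of $F$ (the CDF of the test scores), i.e. $G$ is a CDF whose support lies in $[\underline\theta,\overline\theta]$ with $\int_{\underline\theta}^{s}G(t)\,dt\le\int_{\underline\theta}^{s}F(t)\,dt$ for all $s\in[\underline\theta,\overline\theta]$ and equality at $s=\overline\theta$, and $\phi=(\phi_t,\phi_d)\in\mathbb{R}^2$ consists of a testing fee and a disclosure fee. Call $(G,\phi)$ robustly optimal if for some $\tau\in\mathbb{R}$ the triple $(G,\phi,\tau)$ maximizes the revenue $\phi_t+\phi_d\,(1-G(\tau))$ among all triples, with $G$ a mean-preserving contraction of $F$, $\phi\in\mathbb{R}^2$ and $\tau\in\mathbb{R}$, that satisfy the weak participation constraint $$\phi_t\le\int_{\mu+\phi_d}^{\overline\theta}[s-(\mu+\phi_d)]\,dG(s)$$ (the integral being $0$ if $\mu+\phi_d>\overline\theta$) and the weak-highest equilibrium constraint: $\tau$ is at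 least the lowest score in the support of $G$, $$\tau-\phi_d=E_G[s\mid s\le\tau],\qquad\text{and}\qquad \tau'-\phi_d\ge E_G[s\mid s\le\tau']\ \text{ for all }\tau'>\tau .$$ (If $\tau$ is the lowest score in the support of $G$ and is not an atom, then $E_G[s\mid s\le\tau]$ means $\tau$.) Then there is exactly one robustly optimal test-fee structure $(G^*,\phi^*)$, and it has the following form. (a) There is no testing fee but a strictly positive disclosure fee: $\phi_t^*=0$ and $\phi_d^*=\overline\theta-\mu>0$. (b) The score distribution has an atom at $\underline\theta$ of mass $e^{(\underline\theta-\mu)/(\overline\theta-\mu)}$, a gap above it (no mass in $(\underline\theta,\underline\theta+\overline\theta-\mu)$, an interval that is non-empty), and then an exponential form, with no atom at $\overline\theta$: $$G^*(s)=\begin{cases}0&\text{if }s<\underline\theta,\\ e^{\frac{\underline\theta-\mu}{\overline\theta-\mu}}&\text{if }s\in[\underline\theta,\underline\theta+\overline\theta-\mu),\\ e^{\frac{s-\overline\theta}{\overline\theta-\mu}}&\text{if }s\in[\underline\theta+\overline\theta-\mu,\overline\theta].\end{cases}$$ -/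

import Mathlib

open MeasureTheory ProbabilityTheory Set

noncomputable section

namespace TestFee

/-- A test-fee structure `(G, φ)`: a marginal score distribution `G` (a Borel probability measure
on the real line, identified with its CDF), a testing fee `φ_t` and a disclosure fee `φ_d`. -/
@[ext]
structure TestFeeStructure where
  /-- The marginal distribution `G` of scores. -/
  score : ProbabilityMeasure ℝ
  /-- The testing fee `φ_t`. -/
  testingFee : ℝ
  /-- The disclosure fee `φ_d`. -/
  disclosureFee : ℝ

/-- The mean `μ` of the prior distribution `F` of the asset's value. -/
def priorMean (F : ProbabilityMeasure ℝ) : ℝ := ∫ θ, θ ∂(F : Measure ℝ)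

/-- The lowest value in the support of a distribution. -/
def lowestValue (F : ProbabilityMeasure ℝ) : ℝ := sInf (F : Measure ℝ).support

/-- The highest value in the support of a distribution. -/
def highestValue (F : ProbabilityMeasure ℝ) : ℝ := sSup (F : Measure ℝ).support

/-- `G` is a mean-preserving contraction of `F`: the support of `G` lies in `[θ_lo, θ_hi]`, and
`∫_{θ_lo}^{s} G(t) dt ≤ ∫_{θ_lo}^{s} F(t) dt` for all `s` in `[θ_lo, θ_hi]`, with equality at
`s = θ_hi`, where `θ_lo` and `θ_hi` are the lowest and the highest value in the support of `F`
and `G(t)`, `F(t)` are the CDFs. -/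
def IsMeanPreservingContraction (G F : ProbabilityMeasure ℝ) : Prop :=
  (G : Measure ℝ).support ⊆ Icc (lowestValue F) (highestValue F) ∧
  (∀ s ∈ Icc (lowestValue F) (highestValue F),
    ∫ t in lowestValue F..s, cdf (G : Measure ℝ) t
      ≤ ∫ t in lowestValue F..s, cdf (F : Measure ℝ) t) ∧
  ∫ t in lowestValue F..highestValue F, cdf (G : Measure ℝ) t
    = ∫ t in lowestValue F..highestValue F, cdf (F : Measure ℝ) t

open Classical in
/-- The conditional expectation `E_G[s | s ≤ τ]`, for `τ` at least the lowest score in the support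
of `G`. Then `G(τ) = 0` only happens if `τ` is that lowest score and is not an atom; the conditional
expectation is then understood as the lowest score, which is its limit from the right. -/
def condMeanBelow (G : ProbabilityMeasure ℝ) (τ : ℝ) : ℝ :=
  if (G : Measure ℝ) (Iic τ) = 0 then lowestValue G
  else ∫ s, s ∂(ProbabilityTheory.cond (G : Measure ℝ) (Iic τ))

/-- The weak participation constraint
`φ_t ≤ ∫_{μ + φ_d}^{θ_hi} [s - (μ + φ_d)] dG(s)`
(the integral is over the empty set if `μ + φ_d > θ_hi`). -/
def WeakParticipation (F : ProbabilityMeasure ℝ) (x : TestFeeStructure) : Prop :=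
  x.testingFee ≤
    ∫ s in Icc (priorMean F + x.disclosureFee) (highestValue F),
      (s - (priorMean F + x.disclosureFee)) ∂(x.score : Measure ℝ)

/-- `τ` is a weak-highest equilibrium threshold of `(G, φ)`: it is at least the lowest score in the
support of `G`, `τ - φ_d = E_G[s | s ≤ τ]`, and `τ' - φ_d ≥ E_G[s | s ≤ τ']` for all `τ' > τ`. -/
def IsWeakHighestThreshold (x : TestFeeStructure) (τ : ℝ) : Prop :=
  lowestValue x.score ≤ τ ∧
  τ - x.disclosureFee = condMeanBelow x.score τ ∧
  ∀ τ' : ℝ, τ < τ' → condMeanBelow x.score τ' ≤ τ' - x.disclosureFee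

/-- The intermediary's revenue `φ_t + φ_d (1 - G(τ))` if the asset is tested with probability one
and a score is disclosed exactly when it exceeds `τ`. -/
def revenue (x : TestFeeStructure) (τ : ℝ) : ℝ :=
  x.testingFee + x.disclosureFee * (1 - cdf (x.score : Measure ℝ) τ)

/-- `((G, φ), τ)` is feasible when the prior is `F`: `G` is a mean-preserving contraction of `F`,
and the weak participation and the weak-highest equilibrium constraints hold. -/
def IsFeasible (F : ProbabilityMeasure ℝ) (x : TestFeeStructure) (τ : ℝ) : Prop :=
  IsMeanPreservingContraction x.score F ∧ WeakParticipation F x ∧ IsWeakHighestThreshold x τ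

/-- `(G, φ)` is robustly optimal when the prior is `F`: together with some threshold it solves the
problem of maximizing revenue over all feasible test-fee structures and thresholds. -/
def IsRobustlyOptimal (F : ProbabilityMeasure ℝ) (x : TestFeeStructure) : Prop :=
  ∃ τ : ℝ, IsFeasible F x τ ∧
    ∀ (x' : TestFeeStructure) (τ' : ℝ), IsFeasible F x' τ' → revenue x' τ' ≤ revenue x τ

end TestFee

end

/-! Everything is expressed through the lower partial moment `H` of the scores, whose right
derivative is their CDF `G`. Write `a < b` for the two values, `Δ = b - μ`, and `d` for the
disclosure fee. For a two-point prior, contraction means only support in `[a, b]` and mean `μ`, so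
`H b = Δ`. For `d > 0` the threshold constraint reads `H τ = d * G τ` and `d * G ≤ H` beyond `τ`,
which by Grönwall limits the growth of `H` to rate `1 / d`. It also forces `a + d ≤ τ`.
Participation reads `φ_t ≤ H (μ + d) - d`, so revenue is at most `H (μ + d) - H τ`.

If `d = Δ`, growing backwards from `H b = Δ` gives `H τ ≥ Δ * exp ((τ - b) / Δ)`, hence revenue at
most `Δ * (1 - exp ((a - μ) / Δ))`. Equality fixes `τ`, the exponential form of `H` above it and the
flat part of `G` below it (`eq_of_le_revenue_of_disclosureFee_eq`). If `0 < d < Δ`, the growth bound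
together with the chord of the convex `H` up to `b` gives strictly less (`sub_lt_of_exp_of_chord`);
the comparison rests on `strictMonoOn_inv_exp_sub_one_sub_inv`. The cases `d = 0` and `d > Δ` are
elementary (`revenue_lt_of_disclosureFee_ne`). The bound is attained by `optimalStructure`. -/

/-- The lower partial moment `∫ (x - s)⁺ dP(s)` of a distribution, which is an antiderivative of
its CDF. -/
noncomputable def lowerPartialMoment (P : Measure ℝ) (x : ℝ) : ℝ := ∫ s, max (x - s) 0 ∂P

/-! ### Calculus of the lower partial moment. -/

namespace lowerPartialMoment

variable {P : Measure ℝ}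

open Filter Topology

lemma nonneg (x : ℝ) : 0 ≤ lowerPartialMoment P x :=
  integral_nonneg fun _ => le_max_right _ _

lemma eq_zero_of_le {a b : ℝ} (hab : ∀ᵐ s ∂P, s ∈ Icc a b) {x : ℝ} (hx : x ≤ a) :
    lowerPartialMoment P x = 0 := by
  unfold lowerPartialMoment
  refine integral_eq_zero_of_ae ?_
  filter_upwards [hab] with s hs
  exact max_eq_right (by linarith [hs.1])

variable [IsProbabilityMeasure P]

lemma integrable_max (hP : Integrable (fun s => s) P) (x : ℝ) :
    Integrable (fun s => max (x - s) 0) P :=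
  ((integrable_const x).sub hP).pos_part

lemma integral_indicator_Iic (x c : ℝ) :
    ∫ s, (Iic x).indicator (fun _ => c) s ∂P = c * cdf P x := by
  rw [integral_indicator_const _ measurableSet_Iic, cdf_eq_real, smul_eq_mul, mul_comm]

/-- Passing from `x` to `y` raises the integrand by exactly `y - x` on `s ≤ x` and never lowers it
elsewhere. With `sub_le_mul_cdf` this traps difference quotients between two values of the CDF. -/
lemma mul_cdf_le_sub (hP : Integrable (fun s => s) P) {x y : ℝ} (hxy : x ≤ y) :
    (y - x) * cdf P x ≤ lowerPartialMoment P y - lowerPartialMoment P x := by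
  unfold lowerPartialMoment
  rw [← integral_sub (integrable_max hP y) (integrable_max hP x), ← integral_indicator_Iic]
  refine integral_mono ((integrable_const _).indicator measurableSet_Iic)
    ((integrable_max hP y).sub (integrable_max hP x)) fun s => ?_
  by_cases hs : s ≤ x
  · simp only [indicator, mem_Iic, hs, if_true]
    rw [max_eq_left (by linarith), max_eq_left (by linarith)]; linarith
  · simp only [indicator, mem_Iic, hs, if_false, sub_nonneg]
    gcongr

lemma sub_le_mul_cdf (hP : Integrable (fun s => s) P) {x y : ℝ} (hxy : x ≤ y) :
    lowerPartialMoment P y - lowerPartialMoment P x ≤ (y - x) * cdf P y := by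
  unfold lowerPartialMoment
  rw [← integral_sub (integrable_max hP y) (integrable_max hP x), ← integral_indicator_Iic]
  refine integral_mono ((integrable_max hP y).sub (integrable_max hP x))
    ((integrable_const _).indicator measurableSet_Iic) fun s => ?_
  by_cases hs : s ≤ y
  · simp only [indicator, mem_Iic, hs, if_true]
    rw [max_eq_left (a := y - s) (by linarith)]
    linarith [le_max_left (x - s) 0]
  · push Not at hs
    simp only [indicator, mem_Iic, hs.not_ge, if_false]
    rw [max_eq_right (by linarith), max_eq_right (by linarith), sub_zero]

lemma mono (hP : Integrable (fun s => s) P) : Monotone (lowerPartialMoment P) := fun x y hxy => by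
  have := mul_cdf_le_sub hP hxy
  have := mul_nonneg (sub_nonneg.2 hxy) (cdf_nonneg P x)
  linarith

lemma continuous (hP : Integrable (fun s => s) P) : Continuous (lowerPartialMoment P) := by
  refine (LipschitzWith.of_le_add fun x y => ?_ : LipschitzWith 1 (lowerPartialMoment P)).continuous
  rcases le_total x y with h | h
  · linarith [mono hP h, dist_nonneg (x := x) (y := y)]
  · have := sub_le_mul_cdf hP h
    have := mul_le_of_le_one_right (sub_nonneg.2 h) (cdf_le_one P x)
    rw [Real.dist_eq, abs_of_nonneg (sub_nonneg.2 h)]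
    linarith

/-- Slopes to the right of `x` are squeezed by right-continuity of the CDF. At an atom the left
derivative differs, so one side is all that holds in general. -/
lemma hasDerivWithinAt (hP : Integrable (fun s => s) P) (x : ℝ) :
    HasDerivWithinAt (lowerPartialMoment P) (cdf P x) (Ioi x) x := by
  rw [hasDerivWithinAt_iff_tendsto_slope' self_notMem_Ioi]
  have hr : Tendsto (cdf P) (𝓝[>] x) (𝓝 (cdf P x)) :=
    ((cdf P).right_continuous x).mono Ioi_subset_Ici_self
  refine tendsto_of_tendsto_of_tendsto_of_le_of_le' tendsto_const_nhds hr ?_ ?_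
  · filter_upwards [self_mem_nhdsWithin] with y hy
    have hy' : 0 < y - x := sub_pos.2 hy
    rw [slope_def_field, le_div_iff₀ hy', mul_comm]
    exact mul_cdf_le_sub hP (le_of_lt hy)
  · filter_upwards [self_mem_nhdsWithin] with y hy
    have hy' : 0 < y - x := sub_pos.2 hy
    rw [slope_def_field, div_le_iff₀ hy', mul_comm]
    exact sub_le_mul_cdf hP (le_of_lt hy)

lemma integral_cdf (hP : Integrable (fun s => s) P) {a b : ℝ} (hab : a ≤ b) :
    ∫ t in a..b, cdf P t = lowerPartialMoment P b - lowerPartialMoment P a :=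
  intervalIntegral.integral_eq_sub_of_hasDeriv_right_of_le hab (continuous hP).continuousOn
    (fun x _ => hasDerivWithinAt hP x) (monotone_cdf P).intervalIntegrable

lemma eq_mul_cdf_sub (hP : Integrable (fun s => s) P) (x : ℝ) :
    lowerPartialMoment P x = x * cdf P x - ∫ s in Iic x, s ∂P := by
  unfold lowerPartialMoment
  rw [← integral_indicator_Iic, ← integral_indicator measurableSet_Iic, ← integral_sub
    ((integrable_const _).indicator measurableSet_Iic) (hP.indicator measurableSet_Iic)]
  refine integral_congr_ae (ae_of_all _ fun s => ?_)
  by_cases hs : s ≤ x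
  · simp [indicator, hs]
  · simp [indicator, hs, le_of_not_ge hs]

/-- Convexity of the lower partial moment. -/
lemma mul_le_add (hP : Integrable (fun s => s) P) {a x b : ℝ} (hax : a ≤ x) (hxb : x ≤ b) :
    (b - a) * lowerPartialMoment P x ≤
      (b - x) * lowerPartialMoment P a + (x - a) * lowerPartialMoment P b := by
  unfold lowerPartialMoment
  rw [← integral_const_mul, ← integral_const_mul, ← integral_const_mul, ← integral_add
    ((integrable_max hP a).const_mul _) ((integrable_max hP b).const_mul _)]
  refine integral_mono ((integrable_max hP x).const_mul _)
    (((integrable_max hP a).const_mul _).add ((integrable_max hP b).const_mul _)) fun s => ?_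
  have h1 : 0 ≤ b - x := by linarith
  have h2 : 0 ≤ x - a := by linarith
  have e1 := mul_le_mul_of_nonneg_left (le_max_left (a - s) 0) h1
  have e2 := mul_le_mul_of_nonneg_left (le_max_left (b - s) 0) h2
  have e3 := mul_nonneg h1 (le_max_right (a - s) 0)
  have e4 := mul_nonneg h2 (le_max_right (b - s) 0)
  rcases max_cases (x - s) 0 with ⟨h, _⟩ | ⟨h, _⟩ <;> rw [h] <;> nlinarith

/-- If the CDF is at most `1 / d` times the lower partial moment on `[τ, ∞)`, then the lower partial
moment grows there at most at the rate `1 / d`. -/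
lemma le_mul_exp (hP : Integrable (fun s => s) P) {d τ : ℝ} (hd : 0 < d)
    (h : ∀ x, τ ≤ x → d * cdf P x ≤ lowerPartialMoment P x) {x y : ℝ} (hx : τ ≤ x) (hxy : x ≤ y) :
    lowerPartialMoment P y ≤ lowerPartialMoment P x * Real.exp ((y - x) / d) := by
  have := norm_le_gronwallBound_of_norm_deriv_right_le (f := lowerPartialMoment P) (f' := cdf P)
    (δ := lowerPartialMoment P x) (K := d⁻¹) (ε := 0) (a := x) (b := y)
    (continuous hP).continuousOn
    (fun z _ => (hasDerivWithinAt hP z).Ici_of_Ioi)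
    (by rw [Real.norm_of_nonneg (nonneg x)]) ?_ y ⟨hxy, le_rfl⟩
  · rw [gronwallBound_ε0, Real.norm_of_nonneg (nonneg y)] at this
    rwa [div_eq_inv_mul]
  · intro z hz
    rw [Real.norm_of_nonneg (cdf_nonneg P z), Real.norm_of_nonneg (nonneg z), add_zero,
      inv_mul_eq_div, le_div_iff₀ hd, mul_comm]
    exact h z (hx.trans hz.1)

section Bounded

variable {a b : ℝ}

lemma integrable_of_ae_mem (hab : ∀ᵐ s ∂P, s ∈ Icc a b) : Integrable (fun s => s) P :=
  Integrable.of_mem_Icc a b measurable_id.aemeasurable hab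

lemma eq_sub_of_ge (hab : ∀ᵐ s ∂P, s ∈ Icc a b) {x : ℝ} (hx : b ≤ x) :
    lowerPartialMoment P x = x - ∫ s, s ∂P := by
  have : lowerPartialMoment P x = ∫ s, (x - s) ∂P := by
    refine integral_congr_ae ?_
    filter_upwards [hab] with s hs
    exact max_eq_left (by linarith [hs.2])
  rw [this, integral_sub (integrable_const x) (integrable_of_ae_mem hab)]
  simp

lemma cdf_eq_one_of_ge (hab : ∀ᵐ s ∂P, s ∈ Icc a b) {x : ℝ} (hx : b ≤ x) : cdf P x = 1 := by
  have : P (Iic x) = 1 := by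
    rw [← mem_ae_iff_prob_eq_one measurableSet_Iic]
    filter_upwards [hab] with s hs using hs.2.trans hx
  rw [cdf_eq_real, measureReal_def, this, ENNReal.toReal_one]

lemma cdf_eq_zero_of_lt (hab : ∀ᵐ s ∂P, s ∈ Icc a b) {x : ℝ} (hx : x < a) : cdf P x = 0 := by
  rw [cdf_eq_real, measureReal_eq_zero_iff, measure_eq_zero_iff_ae_notMem]
  filter_upwards [hab] with s hs using not_le.2 (hx.trans_le hs.1)

lemma le_mul_cdf (hab : ∀ᵐ s ∂P, s ∈ Icc a b) {x : ℝ} (hx : a ≤ x) :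
    lowerPartialMoment P x ≤ (x - a) * cdf P x := by
  have := sub_le_mul_cdf (integrable_of_ae_mem hab) hx
  rwa [eq_zero_of_le hab le_rfl, sub_zero] at this

/-- The lower partial moment lies below its chord over the support. -/
lemma mul_le_mul_sub (hab : ∀ᵐ s ∂P, s ∈ Icc a b) {x : ℝ} (hx : x ∈ Icc a b) :
    (b - a) * lowerPartialMoment P x ≤ (x - a) * (b - ∫ s, s ∂P) := by
  have := mul_le_add (integrable_of_ae_mem hab) hx.1 hx.2
  rwa [eq_zero_of_le hab le_rfl, eq_sub_of_ge hab le_rfl, mul_zero, zero_add] at this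

/-- Put-call parity `(s - c)⁺ = (c - s)⁺ - (c - s)`; it turns the option value in the participation
constraint into a lower partial moment. -/
lemma setIntegral_Icc_eq (hab : ∀ᵐ s ∂P, s ∈ Icc a b) (c : ℝ) :
    ∫ s in Icc c b, (s - c) ∂P = lowerPartialMoment P c - (c - ∫ s, s ∂P) := by
  have hi := integrable_of_ae_mem hab
  have hc : ∫ s, (c - s) ∂P = c - ∫ s, s ∂P := by
    rw [integral_sub (integrable_const c) hi]; simp
  unfold lowerPartialMoment
  have hs := integral_sub (integrable_max hi c) ((integrable_const c).sub hi)
  simp only [Pi.sub_apply] at hs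
  rw [← hc, ← hs, ← integral_indicator measurableSet_Icc]
  refine integral_congr_ae ?_
  filter_upwards [hab] with s hs
  by_cases h : c ≤ s
  · rw [indicator_of_mem (show s ∈ Icc c b from ⟨h, hs.2⟩), max_eq_right (by linarith)]; ring
  · rw [indicator_of_notMem (fun h' => h h'.1), max_eq_left (by linarith)]; ring

end Bounded

end lowerPartialMoment

namespace TestFee

/-! ### Equilibrium thresholds in terms of the lower partial moment. -/

section Threshold

variable {G : ProbabilityMeasure ℝ} {a b : ℝ}

lemma ae_mem_of_support_subset {P : Measure ℝ} {s : Set ℝ} (h : P.support ⊆ s) :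
    ∀ᵐ x ∂P, x ∈ s :=
  Filter.mem_of_superset Measure.support_mem_ae h

lemma cdf_ne_zero_iff (x : ℝ) :
    (G : Measure ℝ) (Iic x) ≠ 0 ↔ 0 < cdf (G : Measure ℝ) x := by
  rw [cdf_eq_real, measureReal_nonneg.lt_iff_ne', Ne, Ne, measureReal_eq_zero_iff]

lemma condMeanBelow_eq (hG : Integrable (fun s => s) (G : Measure ℝ)) {x : ℝ}
    (hx : 0 < cdf (G : Measure ℝ) x) :
    condMeanBelow G x = x - lowerPartialMoment G x / cdf (G : Measure ℝ) x := by
  rw [condMeanBelow, if_neg ((cdf_ne_zero_iff x).2 hx), ProbabilityTheory.cond,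
    integral_smul_measure, lowerPartialMoment.eq_mul_cdf_sub hG, ENNReal.toReal_inv,
    ← measureReal_def, ← cdf_eq_real, smul_eq_mul]
  field_simp
  ring

lemma le_lowestValue_of_cdf_eq_zero {x : ℝ}
    (hx : cdf (G : Measure ℝ) x = 0) : x ≤ lowestValue G := by
  refine le_csInf (Measure.nonempty_support (IsProbabilityMeasure.ne_zero _)) ?_
  have : (G : Measure ℝ).support ⊆ Ici x := by
    refine Measure.support_subset_of_isClosed isClosed_Ici ?_
    have h0 : (G : Measure ℝ) (Iic x) = 0 := by
      by_contra h
      exact ((cdf_ne_zero_iff x).1 h).ne' hx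
    have := measure_eq_zero_iff_ae_notMem.1 h0
    filter_upwards [this] with s hs
    exact (not_le.1 (mem_Iic.not.1 hs)).le
  exact fun y hy => this hy

variable {x : TestFeeStructure} {τ : ℝ}

lemma IsWeakHighestThreshold.lowerPartialMoment_eq
    (hx : ∀ᵐ s ∂(x.score : Measure ℝ), s ∈ Icc a b) (h : IsWeakHighestThreshold x τ)
    (hτ : 0 < cdf (x.score : Measure ℝ) τ) :
    lowerPartialMoment x.score τ = x.disclosureFee * cdf (x.score : Measure ℝ) τ := by
  have h2 := h.2.1
  rw [condMeanBelow_eq (lowerPartialMoment.integrable_of_ae_mem hx) hτ] at h2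
  field_simp at h2
  linarith

lemma IsWeakHighestThreshold.disclosureFee_nonneg
    (hx : ∀ᵐ s ∂(x.score : Measure ℝ), s ∈ Icc a b) (h : IsWeakHighestThreshold x τ) :
    0 ≤ x.disclosureFee := by
  rcases (cdf_nonneg (x.score : Measure ℝ) τ).eq_or_lt with hτ | hτ
  · have h2 := h.2.1
    rw [condMeanBelow, if_pos (by by_contra h0; exact ((cdf_ne_zero_iff τ).1 h0).ne hτ)] at h2
    linarith [h.1]
  · have := h.lowerPartialMoment_eq hx hτ
    have h0 := lowerPartialMoment.nonneg (P := (x.score : Measure ℝ)) τ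
    rw [this] at h0
    exact nonneg_of_mul_nonneg_left h0 hτ

/-- If there were no mass up to `τ`, the convention for the conditional mean would put `τ` a
distance `d > 0` above the lowest score, where there is mass. -/
lemma IsWeakHighestThreshold.cdf_pos (h : IsWeakHighestThreshold x τ)
    (hd : 0 < x.disclosureFee) : 0 < cdf (x.score : Measure ℝ) τ := by
  refine (cdf_nonneg (x.score : Measure ℝ) τ).lt_of_ne fun hτ => ?_
  have h2 := h.2.1
  rw [condMeanBelow, if_pos (by by_contra h0; exact ((cdf_ne_zero_iff τ).1 h0).ne hτ)] at h2
  linarith [le_lowestValue_of_cdf_eq_zero hτ.symm]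

lemma IsWeakHighestThreshold.mul_cdf_le
    (hx : ∀ᵐ s ∂(x.score : Measure ℝ), s ∈ Icc a b) (h : IsWeakHighestThreshold x τ)
    (hτ : 0 < cdf (x.score : Measure ℝ) τ) {y : ℝ} (hy : τ ≤ y) :
    x.disclosureFee * cdf (x.score : Measure ℝ) y ≤ lowerPartialMoment x.score y := by
  rcases hy.eq_or_lt with rfl | hy
  · exact (h.lowerPartialMoment_eq hx hτ).ge
  · have hpos := hτ.trans_le (monotone_cdf (x.score : Measure ℝ) hy.le)
    have h2 := h.2.2 y hy
    rw [condMeanBelow_eq (lowerPartialMoment.integrable_of_ae_mem hx) hpos] at h2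
    exact (le_div_iff₀ hpos).1 (by linarith)

/-- Scores below `τ` are within `τ - a` of it, so their conditional mean cannot lie further below
`τ` than that. -/
lemma IsWeakHighestThreshold.add_le
    (hx : ∀ᵐ s ∂(x.score : Measure ℝ), s ∈ Icc a b) (h : IsWeakHighestThreshold x τ)
    (hτ : 0 < cdf (x.score : Measure ℝ) τ) : a + x.disclosureFee ≤ τ := by
  have haτ : a ≤ τ := by
    by_contra! h0
    exact hτ.ne' (lowerPartialMoment.cdf_eq_zero_of_lt hx h0)
  have h1 := lowerPartialMoment.le_mul_cdf hx haτ
  rw [h.lowerPartialMoment_eq hx hτ] at h1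
  linarith [le_of_mul_le_mul_right h1 hτ]

lemma isWeakHighestThreshold_of_lowerPartialMoment
    (hx : Integrable (fun s => s) (x.score : Measure ℝ)) (hle : lowestValue x.score ≤ τ)
    (hτ : 0 < cdf (x.score : Measure ℝ) τ)
    (heq : lowerPartialMoment x.score τ = x.disclosureFee * cdf (x.score : Measure ℝ) τ)
    (h : ∀ y, τ < y → x.disclosureFee * cdf (x.score : Measure ℝ) y ≤
      lowerPartialMoment x.score y) :
    IsWeakHighestThreshold x τ := by
  refine ⟨hle, ?_, fun y hy => ?_⟩
  · rw [condMeanBelow_eq hx hτ, heq, mul_div_cancel_right₀ _ hτ.ne']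
  · have hpos := hτ.trans_le (monotone_cdf (x.score : Measure ℝ) hy.le)
    rw [condMeanBelow_eq hx hpos]
    linarith [(le_div_iff₀ hpos).2 (h y hy)]

end Threshold

/-! ### Priors with two-point support. -/

section TwoPoint

variable {F : ProbabilityMeasure ℝ} {a b : ℝ}

lemma lowestValue_of_support_eq_pair (hab : a < b) (hF : (F : Measure ℝ).support = {a, b}) :
    lowestValue F = a := by
  rw [lowestValue, hF, csInf_pair, min_eq_left hab.le]

lemma highestValue_of_support_eq_pair (hab : a < b) (hF : (F : Measure ℝ).support = {a, b}) :
    highestValue F = b := by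
  rw [highestValue, hF, csSup_pair, max_eq_right hab.le]

lemma ae_mem_Icc_of_support_eq_pair (hab : a < b) (hF : (F : Measure ℝ).support = {a, b}) :
    ∀ᵐ s ∂(F : Measure ℝ), s ∈ Icc a b := by
  refine ae_mem_of_support_subset ?_
  rw [hF]
  rintro x (rfl | rfl)
  exacts [⟨le_rfl, hab.le⟩, ⟨hab.le, le_rfl⟩]

/-- A mean at an endpoint would concentrate all mass there, but the other endpoint is in the support
too. -/
lemma priorMean_mem_Ioo (hab : a < b) (hF : (F : Measure ℝ).support = {a, b}) :
    priorMean F ∈ Ioo a b := by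
  have hmem := ae_mem_Icc_of_support_eq_pair hab hF
  have hi := lowerPartialMoment.integrable_of_ae_mem hmem
  have key : ∀ c ∈ (F : Measure ℝ).support, ∀ e, e ≠ c →
      ¬ ((fun s => s - e) =ᵐ[(F : Measure ℝ)] 0) := by
    intro c hc e he h0
    have : (F : Measure ℝ).support ⊆ {e} := by
      refine Measure.support_subset_of_isClosed isClosed_singleton ?_
      filter_upwards [h0] with s hs
      exact sub_eq_zero.1 hs
    exact he (this hc).symm
  constructor
  · have h0 : 0 ≤ᵐ[(F : Measure ℝ)] fun s => s - a := by
      filter_upwards [hmem] with s hs using sub_nonneg.2 hs.1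
    have h1 : ∫ s, (s - a) ∂(F : Measure ℝ) = priorMean F - a := by
      rw [integral_sub hi (integrable_const a)]; simp [priorMean]
    refine sub_pos.1 (h1 ▸ (integral_nonneg_of_ae h0).lt_of_ne fun h => ?_)
    exact key b (by simp [hF]) a hab.ne
      ((integral_eq_zero_iff_of_nonneg_ae h0 (hi.sub (integrable_const a))).1 h.symm)
  · have h0 : 0 ≤ᵐ[(F : Measure ℝ)] fun s => b - s := by
      filter_upwards [hmem] with s hs using sub_nonneg.2 hs.2
    have h1 : ∫ s, (b - s) ∂(F : Measure ℝ) = b - priorMean F := by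
      rw [integral_sub (integrable_const b) hi]; simp [priorMean]
    refine sub_pos.1 (h1 ▸ (integral_nonneg_of_ae h0).lt_of_ne fun h => ?_)
    refine key a (by simp [hF]) b hab.ne' ?_
    filter_upwards [(integral_eq_zero_iff_of_nonneg_ae h0 ((integrable_const b).sub hi)).1 h.symm]
      with s hs
    have : b - s = 0 := hs
    simp only [Pi.zero_apply]
    linarith

/-- At both support points the integrand agrees with its chord, so the prior attains the upper bound
that convexity imposes on any distribution on `[a, b]` with its mean. -/
lemma lowerPartialMoment_of_support_eq_pair (hab : a < b)
    (hF : (F : Measure ℝ).support = {a, b}) {x : ℝ} (hx : x ∈ Icc a b) :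
    (b - a) * lowerPartialMoment F x = (x - a) * (b - priorMean F) := by
  have hi := lowerPartialMoment.integrable_of_ae_mem (ae_mem_Icc_of_support_eq_pair hab hF)
  have h1 : ∫ s, (b - s) ∂(F : Measure ℝ) = b - priorMean F := by
    rw [integral_sub (integrable_const b) hi]; simp [priorMean]
  unfold lowerPartialMoment
  rw [← h1, ← integral_const_mul, ← integral_const_mul]
  refine integral_congr_ae ?_
  filter_upwards [ae_mem_of_support_subset hF.le] with s hs
  rcases hs with rfl | rfl
  · rw [max_eq_left (by linarith [hx.1])]; ring
  · rw [max_eq_right (by linarith [hx.2])]; ring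

/-- The mean-preserving contractions of a distribution with two-point support are the distributions
on the interval between these points that have the same mean. -/
lemma isMeanPreservingContraction_iff {G : ProbabilityMeasure ℝ} (hab : a < b)
    (hF : (F : Measure ℝ).support = {a, b}) :
    IsMeanPreservingContraction G F ↔
      (G : Measure ℝ).support ⊆ Icc a b ∧ ∫ s, s ∂(G : Measure ℝ) = priorMean F := by
  have hFmem := ae_mem_Icc_of_support_eq_pair hab hF
  have hFi := lowerPartialMoment.integrable_of_ae_mem hFmem
  have hpair := fun {x} => lowerPartialMoment_of_support_eq_pair hab hF (x := x)
  rw [IsMeanPreservingContraction, lowestValue_of_support_eq_pair hab hF,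
    highestValue_of_support_eq_pair hab hF, lowerPartialMoment.integral_cdf hFi hab.le,
    lowerPartialMoment.eq_zero_of_le hFmem le_rfl, lowerPartialMoment.eq_sub_of_ge hFmem le_rfl]
  refine and_congr_right fun hsupp => ?_
  have hGmem := ae_mem_of_support_subset hsupp
  have hGi := lowerPartialMoment.integrable_of_ae_mem hGmem
  rw [lowerPartialMoment.integral_cdf hGi hab.le,
    lowerPartialMoment.eq_zero_of_le hGmem le_rfl, lowerPartialMoment.eq_sub_of_ge hGmem le_rfl]
  constructor
  · rintro ⟨-, h⟩
    rw [priorMean]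
    linarith
  · intro h
    refine ⟨fun s hs => ?_, by rw [h, priorMean]⟩
    rw [lowerPartialMoment.integral_cdf hGi hs.1, lowerPartialMoment.integral_cdf hFi hs.1,
      lowerPartialMoment.eq_zero_of_le hGmem le_rfl,
      lowerPartialMoment.eq_zero_of_le hFmem le_rfl, sub_zero, sub_zero]
    refine le_of_mul_le_mul_left ?_ (sub_pos.2 hab)
    rw [hpair hs, ← h]
    exact lowerPartialMoment.mul_le_mul_sub hGmem hs

end TwoPoint

end TestFee

/-! ### Real inequalities for disclosure fees below `b - μ`. -/

/-- The derivative is positive iff `x ^ 2 * exp x < (exp x - 1) ^ 2`; taking roots and dividing by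
`2 * exp (x / 2)`, this is `x / 2 < sinh (x / 2)`. -/
lemma strictMonoOn_inv_exp_sub_one_sub_inv :
    StrictMonoOn (fun x : ℝ => (Real.exp x - 1)⁻¹ - x⁻¹) (Ioi 0) := by
  have hpos : ∀ x ∈ Ioi (0 : ℝ), 0 < Real.exp x - 1 := fun x hx =>
    sub_pos.2 (Real.one_lt_exp_iff.2 hx)
  have hder : ∀ x ∈ Ioi (0 : ℝ), HasDerivAt (fun x : ℝ => (Real.exp x - 1)⁻¹ - x⁻¹)
      (-Real.exp x / (Real.exp x - 1) ^ 2 - -(x ^ 2)⁻¹) x := fun x hx =>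
    (((Real.hasDerivAt_exp x).sub_const 1).inv (hpos x hx).ne').sub
      (hasDerivAt_inv (ne_of_gt hx))
  refine strictMonoOn_of_deriv_pos (convex_Ioi 0)
    (fun x hx => (hder x hx).continuousAt.continuousWithinAt) fun x hx => ?_
  rw [interior_Ioi] at hx
  rw [(hder x hx).deriv]
  have hx0 : 0 < x := hx
  have h1 := hpos x hx
  have hs : x / 2 < Real.sinh (x / 2) := Real.self_lt_sinh_iff.2 (by positivity)
  have hE : Real.exp x - 1 = 2 * Real.exp (x / 2) * Real.sinh (x / 2) := by
    have e1 : Real.exp x = Real.exp (x / 2) * Real.exp (x / 2) := by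
      rw [← Real.exp_add, add_halves]
    have e2 : Real.exp (x / 2) * Real.exp (-(x / 2)) = 1 := by
      rw [← Real.exp_add, add_neg_cancel, Real.exp_zero]
    rw [Real.sinh_eq, e1]
    linear_combination e2
  have hlt : Real.exp x * x ^ 2 < (Real.exp x - 1) ^ 2 := by
    have e1 : Real.exp x = Real.exp (x / 2) ^ 2 := by
      rw [sq, ← Real.exp_add, add_halves]
    rw [hE, e1, ← mul_pow]
    have h2 := mul_lt_mul_of_pos_left hs (Real.exp_pos (x / 2))
    exact pow_lt_pow_left₀ (by linarith) (by positivity) two_ne_zero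
  have : Real.exp x / (Real.exp x - 1) ^ 2 < (x ^ 2)⁻¹ := by
    rw [inv_eq_one_div, div_lt_div_iff₀ (by positivity) (by positivity)]
    linarith
  rw [neg_div]
  linarith

/-- The increment of a function that grows at most at the rate `1 / d` and lies below a chord, as
long as `d` is smaller than the terminal value `Δ` of the chord. -/
lemma sub_lt_of_exp_of_chord {A h d v m Δ : ℝ} (hd : 0 < d) (hdΔ : d < Δ) (hv : 0 < v)
    (hvm : v ≤ m) (hexp : A ≤ h * Real.exp (v / d))
    (hchord : (Δ - d + v) * A ≤ (Δ - d) * h + v * Δ) :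
    A - h < Δ * (1 - Real.exp (-m / Δ)) := by
  have hm : 0 < m := hv.trans_le hvm
  have hΔ : 0 < Δ := hd.trans hdΔ
  have hk := strictMonoOn_inv_exp_sub_one_sub_inv (a := m / Δ) (b := m / d)
    (div_pos hm hΔ) (div_pos hm hd) (by gcongr)
  simp only [inv_div] at hk
  set E := Real.exp (v / d) - 1 with hE
  have hEpos : 0 < E := sub_pos.2 (Real.one_lt_exp_iff.2 (by positivity))
  have hEle : E ≤ Real.exp (m / d) - 1 := by rw [hE]; gcongr
  have hEM : (Real.exp (m / d) - 1)⁻¹ ≤ E⁻¹ := by gcongr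
  have hM : 0 < Real.exp (m / Δ) - 1 := sub_pos.2 (Real.one_lt_exp_iff.2 (by positivity))
  have hcv : (Δ - d) / m ≤ (Δ - d) / v := by
    have : 0 ≤ Δ - d := by linarith
    gcongr
  have hV : (1 - Real.exp (-m / Δ))⁻¹ = 1 + (Real.exp (m / Δ) - 1)⁻¹ := by
    have e : Real.exp (-m / Δ) = (Real.exp (m / Δ))⁻¹ := by rw [neg_div, Real.exp_neg]
    rw [e]
    have := Real.exp_pos (m / Δ)
    field_simp
    ring
  have hVpos : 0 < 1 - Real.exp (-m / Δ) :=
    sub_pos.2 (Real.exp_lt_one_iff.2 (div_neg_of_neg_of_pos (by linarith) hΔ))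
  -- Both hypotheses are rewritten as bounds on `A - h`; weighting them by `v` and `E` eliminates
  -- `h`.
  have h1 : A - h ≤ h * E := by rw [hE]; linarith
  have h2 : (A - h) * (v + E * (Δ - d + v)) ≤ E * v * Δ := by
    have h3 : v * h ≤ v * Δ - (A - h) * (Δ - d + v) := by linarith
    have h4 := mul_le_mul_of_nonneg_left h1 hv.le
    have h5 := mul_le_mul_of_nonneg_left h3 hEpos.le
    linarith
  have h3 : (A - h) * (E⁻¹ + (Δ - d) / v + 1) ≤ Δ := by
    have : (A - h) * (E⁻¹ + (Δ - d) / v + 1) =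
        (A - h) * (v + E * (Δ - d + v)) / (E * v) := by
      field_simp
      ring
    rw [this, div_le_iff₀ (by positivity)]
    linarith
  have h4 : (1 - Real.exp (-m / Δ))⁻¹ < E⁻¹ + (Δ - d) / v + 1 := by
    rw [hV]
    rw [sub_div] at hcv
    linarith
  by_contra! hcon
  have hApos : 0 < A - h := (mul_pos hΔ hVpos).trans_le hcon
  have h5 := mul_lt_mul_of_pos_left h4 hApos
  have h6 := mul_le_mul_of_nonneg_right hcon (inv_pos.2 hVpos).le
  rw [mul_assoc, mul_inv_cancel₀ hVpos.ne', mul_one] at h6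
  linarith

/-! ### The revenue bound and its equality case. -/

namespace TestFee

variable {F : ProbabilityMeasure ℝ} {a b : ℝ} {x : TestFeeStructure} {τ : ℝ}

/-- The CDF of the optimal scores: an atom at `a`, a gap of length `b - μ`, and an exponential
form up to `b`. -/
noncomputable def optimalCDF (a b μ s : ℝ) : ℝ :=
  if s < a then 0 else Real.exp ((min (max s (a + b - μ)) b - b) / (b - μ))

lemma testingFee_le (hab : a < b) (hF : (F : Measure ℝ).support = {a, b})
    (hx : IsFeasible F x τ) :
    x.testingFee ≤
      lowerPartialMoment x.score (priorMean F + x.disclosureFee) - x.disclosureFee := by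
  obtain ⟨hmpc, hpart, -⟩ := hx
  rw [isMeanPreservingContraction_iff hab hF] at hmpc
  rw [WeakParticipation, highestValue_of_support_eq_pair hab hF,
    lowerPartialMoment.setIntegral_Icc_eq (ae_mem_of_support_subset hmpc.1), hmpc.2] at hpart
  linarith

lemma mul_one_sub_exp_pos {μ : ℝ} (hμ : μ ∈ Ioo a b) :
    0 < (b - μ) * (1 - Real.exp ((a - μ) / (b - μ))) :=
  mul_pos (sub_pos.2 hμ.2) (sub_pos.2 (Real.exp_lt_one_iff.2
    (div_neg_of_neg_of_pos (sub_neg.2 hμ.1) (sub_pos.2 hμ.2))))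

/-- A feasible structure whose disclosure fee differs from `b - μ` has suboptimal revenue. -/
lemma revenue_lt_of_disclosureFee_ne (hab : a < b) (hF : (F : Measure ℝ).support = {a, b})
    (hx : IsFeasible F x τ) (hd : x.disclosureFee ≠ b - priorMean F) :
    revenue x τ < (b - priorMean F) * (1 - Real.exp ((a - priorMean F) / (b - priorMean F))) := by
  have hμ := priorMean_mem_Ioo hab hF
  have ht := testingFee_le hab hF hx
  obtain ⟨hmpc, -, heq⟩ := hx
  obtain ⟨hsupp, hmean⟩ := (isMeanPreservingContraction_iff hab hF).1 hmpc
  have hmem := ae_mem_of_support_subset hsupp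
  have hi := lowerPartialMoment.integrable_of_ae_mem hmem
  have hV := mul_one_sub_exp_pos hμ
  set μ := priorMean F
  set P := (x.score : Measure ℝ)
  have hm : 0 < μ - a := sub_pos.2 hμ.1
  have hΔ : 0 < b - μ := sub_pos.2 hμ.2
  rw [revenue]
  -- With `d = 0` there is no growth bound; the chord bound at `μ` and `1 + z < exp z` for `z = (μ -
  -- a) / (b - μ)` suffice.
  rcases (heq.disclosureFee_nonneg hmem).eq_or_lt with hd0 | hd0
  · rw [← hd0] at ht ⊢
    have h1 := lowerPartialMoment.mul_le_mul_sub hmem ⟨hμ.1.le, hμ.2.le⟩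
    rw [hmean] at h1
    rw [add_zero, sub_zero] at ht
    rw [zero_mul, add_zero]
    refine ht.trans_lt ?_
    have h2 : (b - μ) / (b - a) = (1 + (μ - a) / (b - μ))⁻¹ := by
      rw [one_add_div hΔ.ne', inv_div, sub_add_sub_cancel]
    have h3 : Real.exp ((a - μ) / (b - μ)) < (b - μ) / (b - a) := by
      have : (a - μ) / (b - μ) = -((μ - a) / (b - μ)) := by ring
      rw [this, Real.exp_neg, h2]
      gcongr
      rw [add_comm]
      exact Real.add_one_lt_exp (by positivity)
    rw [lt_div_iff₀ (by linarith)] at h3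
    refine lt_of_mul_lt_mul_left (h1.trans_lt ?_) (sub_pos.2 hab).le
    nlinarith
  · have hτ := heq.cdf_pos hd0
    have hHτ := heq.lowerPartialMoment_eq hmem hτ
    have hτa := heq.add_le hmem hτ
    have hmono := lowerPartialMoment.mono hi
    have hR : x.testingFee + x.disclosureFee * (1 - cdf P τ) ≤
        lowerPartialMoment P (μ + x.disclosureFee) - lowerPartialMoment P τ := by
      rw [hHτ]; linarith
    refine hR.trans_lt ?_
    rcases le_or_gt (μ + x.disclosureFee) τ with hle | hlt
    · linarith [hmono hle]
    -- A threshold at or above `b` satisfies `τ - μ = d`, contradicting `τ < μ + d`.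
    rcases le_or_gt b τ with hbτ | hbτ
    · have h1 := lowerPartialMoment.eq_sub_of_ge hmem hbτ
      rw [hHτ, lowerPartialMoment.cdf_eq_one_of_ge hmem hbτ, hmean] at h1
      linarith
    have hdΔ : x.disclosureFee < b - μ := by
      refine lt_of_le_of_ne ?_ hd
      -- The growth condition at `b`, where the CDF is one, rules out `d > b - μ`.
      have h1 := heq.mul_cdf_le hmem hτ hbτ.le
      rwa [lowerPartialMoment.cdf_eq_one_of_ge hmem le_rfl,
        lowerPartialMoment.eq_sub_of_ge hmem le_rfl, hmean, mul_one] at h1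
    have hchord := lowerPartialMoment.mul_le_add hi hlt.le (show μ + x.disclosureFee ≤ b by linarith)
    rw [lowerPartialMoment.eq_sub_of_ge hmem le_rfl, hmean] at hchord
    have := sub_lt_of_exp_of_chord (m := μ - a) hd0 hdΔ (sub_pos.2 hlt) (by linarith)
      (lowerPartialMoment.le_mul_exp hi hd0 (fun y hy => heq.mul_cdf_le hmem hτ hy) le_rfl hlt.le)
      (by rw [← sub_sub] at hchord; convert hchord using 2; ring)
    rwa [neg_sub] at this

/-- A feasible structure with disclosure fee `b - μ` that reaches the optimal revenue. -/
lemma eq_of_le_revenue_of_disclosureFee_eq (hab : a < b) (hF : (F : Measure ℝ).support = {a, b})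
    (hx : IsFeasible F x τ) (hd : x.disclosureFee = b - priorMean F)
    (hR : (b - priorMean F) * (1 - Real.exp ((a - priorMean F) / (b - priorMean F)))
      ≤ revenue x τ) :
    revenue x τ = (b - priorMean F) * (1 - Real.exp ((a - priorMean F) / (b - priorMean F))) ∧
    x.testingFee = 0 ∧
    ∀ s, cdf (x.score : Measure ℝ) s = optimalCDF a b (priorMean F) s := by
  have hμ := priorMean_mem_Ioo hab hF
  have ht := testingFee_le hab hF hx
  obtain ⟨hmpc, -, heq⟩ := hx
  obtain ⟨hsupp, hmean⟩ := (isMeanPreservingContraction_iff hab hF).1 hmpc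
  have hmem := ae_mem_of_support_subset hsupp
  have hi := lowerPartialMoment.integrable_of_ae_mem hmem
  have hV := mul_one_sub_exp_pos hμ
  set μ := priorMean F
  set P := (x.score : Measure ℝ)
  have hΔ : 0 < b - μ := sub_pos.2 hμ.2
  have hτ := heq.cdf_pos (hd ▸ hΔ)
  have hHτ := heq.lowerPartialMoment_eq hmem hτ
  have hτa := heq.add_le hmem hτ
  have hgrowth := fun y (hy : τ ≤ y) => heq.mul_cdf_le hmem hτ hy
  rw [hd] at ht hHτ hτa hgrowth
  have hHb : lowerPartialMoment P b = b - μ := by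
    rw [lowerPartialMoment.eq_sub_of_ge hmem le_rfl, hmean]
  rw [add_sub_cancel, hHb, sub_self] at ht
  have hrev : revenue x τ = x.testingFee + (b - μ) - lowerPartialMoment P τ := by
    rw [revenue, hd, hHτ]; ring
  have hbτ : τ < b := by
    by_contra! hbτ
    rw [hrev, lowerPartialMoment.eq_sub_of_ge hmem hbτ, hmean] at hR
    linarith
  have hexp : ∀ y z, τ ≤ y → y ≤ z → lowerPartialMoment P z ≤
      lowerPartialMoment P y * Real.exp ((z - y) / (b - μ)) := fun y z =>
    lowerPartialMoment.le_mul_exp hi hΔ hgrowth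
  have hlow : ∀ y, τ ≤ y → y ≤ b →
      (b - μ) * Real.exp ((y - b) / (b - μ)) ≤ lowerPartialMoment P y := by
    intro y hy hyb
    have h1 := mul_le_mul_of_nonneg_right (hexp y b hy hyb) (Real.exp_pos ((y - b) / (b - μ))).le
    rwa [hHb, mul_assoc, ← Real.exp_add, ← add_div, sub_add_sub_cancel, sub_self, zero_div,
      Real.exp_zero, mul_one] at h1
  have h1 := hlow τ le_rfl hbτ.le
  have h2 : Real.exp ((a - μ) / (b - μ)) ≤ Real.exp ((τ - b) / (b - μ)) := by
    refine Real.exp_le_exp.2 (div_le_div_of_nonneg_right ?_ hΔ.le)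
    linarith
  have h3 := mul_le_mul_of_nonneg_left h2 hΔ.le
  -- From here the assumed revenue makes every inequality in the chain tight.
  have htest : x.testingFee = 0 := by linarith
  have h4 : Real.exp ((τ - b) / (b - μ)) ≤ Real.exp ((a - μ) / (b - μ)) :=
    le_of_mul_le_mul_left (by linarith) hΔ
  have hτeq : τ = a + b - μ := by
    rw [Real.exp_le_exp, div_le_div_iff_of_pos_right hΔ] at h4
    linarith
  have hHτ' : lowerPartialMoment P τ = (b - μ) * Real.exp ((τ - b) / (b - μ)) := by linarith
  have hH : ∀ y ∈ Icc τ b, lowerPartialMoment P y = (b - μ) * Real.exp ((y - b) / (b - μ)) := by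
    intro y hy
    refine le_antisymm ?_ (hlow y hy.1 hy.2)
    have h5 := hexp τ y le_rfl hy.1
    rwa [hHτ', mul_assoc, ← Real.exp_add, ← add_div, sub_add_sub_cancel']  at h5
  have hupper : ∀ y ∈ Icc τ b, cdf P y = Real.exp ((y - b) / (b - μ)) := by
    intro y hy
    -- The CDF is read off as a right derivative; at `b` the formula for the moment is not available
    -- to the right.
    rcases hy.2.eq_or_lt with rfl | hyb
    · rw [lowerPartialMoment.cdf_eq_one_of_ge hmem le_rfl, sub_self, zero_div, Real.exp_zero]
    · have hder := lowerPartialMoment.hasDerivWithinAt hi y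
      have hder' : HasDerivWithinAt (lowerPartialMoment P) (Real.exp ((y - b) / (b - μ)))
          (Ioi y) y := by
        have h6 : HasDerivAt (fun y => (b - μ) * Real.exp ((y - b) / (b - μ)))
            ((b - μ) * (Real.exp ((y - b) / (b - μ)) * (1 / (b - μ)))) y :=
          ((((hasDerivAt_id y).sub_const b).div_const _).exp).const_mul _
        have h7 : (b - μ) * (Real.exp ((y - b) / (b - μ)) * (1 / (b - μ))) =
            Real.exp ((y - b) / (b - μ)) := by field_simp
        rw [h7] at h6
        refine h6.hasDerivWithinAt.congr_of_eventuallyEq ?_ (hH y hy)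
        filter_upwards [Ioo_mem_nhdsGT hyb] with z hz using hH z ⟨hy.1.trans hz.1.le, hz.2.le⟩
      exact (uniqueDiffWithinAt_Ioi y).eq_deriv _ hder hder'
  -- Now `H τ = (τ - a) * G τ`, while splitting at `y` gives `H τ ≤ (τ - y) * G τ + (y - a) * G y`.
  -- Cancelling needs `a < y`; the point `a` follows by right-continuity.
  have hflat : ∀ y ∈ Ioc a τ, cdf P y = cdf P τ := by
    intro y hy
    refine le_antisymm (monotone_cdf P hy.2) ?_
    have h5 := lowerPartialMoment.sub_le_mul_cdf hi hy.2
    have h6 := lowerPartialMoment.le_mul_cdf hmem hy.1.le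
    have h7 : b - μ = τ - a := by linarith
    rw [hHτ, h7] at h5
    have h8 : (y - a) * cdf P τ ≤ (y - a) * cdf P y := by linarith
    exact le_of_mul_le_mul_left h8 (sub_pos.2 hy.1)
  have hflat' : ∀ y ∈ Icc a τ, cdf P y = cdf P τ := by
    intro y hy
    rcases hy.1.eq_or_lt with rfl | hay
    · have hr := ((cdf P).right_continuous a).mono Ioi_subset_Ici_self
      refine tendsto_nhds_unique hr (tendsto_const_nhds.congr' ?_)
      filter_upwards [Ioo_mem_nhdsGT (show a < τ by linarith)] with z hz
      exact (hflat z ⟨hz.1, hz.2.le⟩).symm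
    · exact hflat y ⟨hay, hy.2⟩
  refine ⟨le_antisymm (by linarith) hR, htest, fun s => ?_⟩
  rw [optimalCDF, ← hτeq]
  split_ifs with hs
  · exact lowerPartialMoment.cdf_eq_zero_of_lt hmem hs
  push Not at hs
  rcases le_total s τ with h | h
  · rw [max_eq_right h, min_eq_left hbτ.le, hflat' s ⟨hs, h⟩, hupper τ ⟨le_rfl, hbτ.le⟩]
  rcases le_total s b with h' | h'
  · rw [max_eq_left h, min_eq_left h', hupper s ⟨h, h'⟩]
  · rw [max_eq_left h, min_eq_right h', sub_self, zero_div, Real.exp_zero,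
      lowerPartialMoment.cdf_eq_one_of_ge hmem h']

end TestFee

namespace TestFee

/-! ### The optimal score distribution. -/

section OptimalScore

open Filter Topology

variable {a b μ : ℝ}

lemma optimalCDF_of_lt {s : ℝ} (hs : s < a) : optimalCDF a b μ s = 0 := if_pos hs

lemma optimalCDF_of_ge {s : ℝ} (hs : a ≤ s) :
    optimalCDF a b μ s = Real.exp ((min (max s (a + b - μ)) b - b) / (b - μ)) :=
  if_neg (not_lt.2 hs)

lemma optimalCDF_of_mem_gap (hμ : μ ∈ Ioo a b) {s : ℝ} (hs : s ∈ Icc a (a + b - μ)) :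
    optimalCDF a b μ s = Real.exp ((a - μ) / (b - μ)) := by
  rw [optimalCDF_of_ge hs.1, max_eq_right hs.2, min_eq_left (by linarith [hμ.1])]
  congr 2
  ring

lemma optimalCDF_of_mem_upper (hμ : μ ∈ Ioo a b) {s : ℝ} (hs : s ∈ Icc (a + b - μ) b) :
    optimalCDF a b μ s = Real.exp ((s - b) / (b - μ)) := by
  rw [optimalCDF_of_ge (by linarith [hμ.2, hs.1]), max_eq_left hs.1, min_eq_left hs.2]

lemma optimalCDF_of_top_le (hμ : μ ∈ Ioo a b) {s : ℝ} (hs : b ≤ s) :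
    optimalCDF a b μ s = 1 := by
  rw [optimalCDF_of_ge (by linarith [hμ.1, hμ.2]), min_eq_right (le_max_of_le_left hs), sub_self,
    zero_div, Real.exp_zero]

lemma continuous_exp_min_max (a b μ : ℝ) :
    Continuous fun s => Real.exp ((min (max s (a + b - μ)) b - b) / (b - μ)) := by
  fun_prop

/-- `optimalCDF` as a Stieltjes function. -/
@[simps]
noncomputable def optimalStieltjes (hμ : μ ∈ Ioo a b) : StieltjesFunction ℝ where
  toFun := optimalCDF a b μ
  mono' x y hxy := by
    have hΔ : 0 < b - μ := sub_pos.2 hμ.2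
    rcases lt_or_ge x a with hx | hx
    · rw [optimalCDF_of_lt hx, optimalCDF]
      split_ifs
      exacts [le_rfl, (Real.exp_pos _).le]
    · rw [optimalCDF_of_ge hx, optimalCDF_of_ge (hx.trans hxy)]
      gcongr
  right_continuous' x := by
    rcases lt_or_ge x a with hx | hx
    · refine (continuousAt_const (y := (0 : ℝ)).congr ?_).continuousWithinAt
      filter_upwards [Iio_mem_nhds hx] with y hy using (optimalCDF_of_lt hy).symm
    · exact (continuous_exp_min_max a b μ).continuousWithinAt.congr
        (fun y hy => optimalCDF_of_ge (hx.trans hy)) (optimalCDF_of_ge hx)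

lemma tendsto_optimalStieltjes_atBot (hμ : μ ∈ Ioo a b) :
    Tendsto (optimalStieltjes hμ) atBot (𝓝 0) :=
  tendsto_const_nhds.congr' ((eventually_lt_atBot a).mono fun _ hs => (optimalCDF_of_lt hs).symm)

lemma tendsto_optimalStieltjes_atTop (hμ : μ ∈ Ioo a b) :
    Tendsto (optimalStieltjes hμ) atTop (𝓝 1) :=
  tendsto_const_nhds.congr'
    ((eventually_ge_atTop b).mono fun _ hs => (optimalCDF_of_top_le hμ hs).symm)

/-- The distribution with CDF `optimalCDF`. -/
noncomputable def optimalScore (hμ : μ ∈ Ioo a b) : ProbabilityMeasure ℝ :=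
  ⟨(optimalStieltjes hμ).measure, (optimalStieltjes hμ).isProbabilityMeasure
    (tendsto_optimalStieltjes_atBot hμ) (tendsto_optimalStieltjes_atTop hμ)⟩

lemma cdf_optimalScore (hμ : μ ∈ Ioo a b) (s : ℝ) :
    cdf (optimalScore hμ : Measure ℝ) s = optimalCDF a b μ s :=
  congrArg (fun f : StieltjesFunction ℝ => f s) (cdf_measure_stieltjesFunction _
    (tendsto_optimalStieltjes_atBot hμ) (tendsto_optimalStieltjes_atTop hμ))

lemma leftLim_optimalStieltjes_bot (hμ : μ ∈ Ioo a b) :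
    Function.leftLim (optimalStieltjes hμ) a = 0 := by
  refine leftLim_eq_of_tendsto (tendsto_const_nhds.congr' ?_)
  filter_upwards [self_mem_nhdsWithin] with s hs using (optimalCDF_of_lt hs).symm

lemma leftLim_optimalStieltjes_top (hμ : μ ∈ Ioo a b) :
    Function.leftLim (optimalStieltjes hμ) b = 1 := by
  have hc := ((continuous_exp_min_max a b μ).tendsto b).mono_left
    (nhdsWithin_le_nhds (s := Iio b))
  rw [← optimalCDF_of_ge (hμ.1.trans hμ.2).le, optimalCDF_of_top_le hμ le_rfl] at hc
  refine leftLim_eq_of_tendsto (hc.congr' ?_)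
  filter_upwards [Ioo_mem_nhdsLT (hμ.1.trans hμ.2)] with s hs
  exact (optimalCDF_of_ge hs.1.le).symm

lemma optimalScore_singleton_bot (hμ : μ ∈ Ioo a b) :
    (optimalScore hμ : Measure ℝ) {a} = ENNReal.ofReal (Real.exp ((a - μ) / (b - μ))) := by
  change (optimalStieltjes hμ).measure {a} = _
  rw [StieltjesFunction.measure_singleton, leftLim_optimalStieltjes_bot, sub_zero,
    optimalStieltjes_apply, optimalCDF_of_mem_gap hμ ⟨le_rfl, by linarith [hμ.2]⟩]

lemma optimalScore_singleton_top (hμ : μ ∈ Ioo a b) :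
    (optimalScore hμ : Measure ℝ) {b} = 0 := by
  change (optimalStieltjes hμ).measure {b} = _
  rw [StieltjesFunction.measure_singleton, leftLim_optimalStieltjes_top,
    optimalStieltjes_apply, optimalCDF_of_top_le hμ le_rfl, sub_self, ENNReal.ofReal_zero]

lemma optimalScore_gap (hμ : μ ∈ Ioo a b) :
    (optimalScore hμ : Measure ℝ) (Ioo a (a + b - μ)) = 0 := by
  refine measure_mono_null Ioo_subset_Ioc_self ?_
  change (optimalStieltjes hμ).measure _ = _
  have h : a ≤ a + b - μ := by linarith [hμ.2]
  rw [StieltjesFunction.measure_Ioc, optimalStieltjes_apply, optimalStieltjes_apply,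
    optimalCDF_of_mem_gap hμ ⟨le_rfl, h⟩, optimalCDF_of_mem_gap hμ ⟨h, le_rfl⟩, sub_self,
    ENNReal.ofReal_zero]

lemma support_optimalScore_subset (hμ : μ ∈ Ioo a b) :
    (optimalScore hμ : Measure ℝ).support ⊆ Icc a b := by
  refine Measure.support_subset_of_isClosed isClosed_Icc ?_
  rw [mem_ae_iff_prob_eq_one measurableSet_Icc]
  change (optimalStieltjes hμ).measure _ = _
  rw [StieltjesFunction.measure_Icc, leftLim_optimalStieltjes_bot, optimalStieltjes_apply,
    optimalCDF_of_top_le hμ le_rfl, sub_zero, ENNReal.ofReal_one]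

lemma lowestValue_optimalScore_le (hμ : μ ∈ Ioo a b) : lowestValue (optimalScore hμ) ≤ a := by
  refine csInf_le (bddBelow_Icc.mono (support_optimalScore_subset hμ)) ?_
  rw [Measure.mem_support_iff_forall]
  intro U hU
  refine lt_of_lt_of_le ?_ (measure_mono (singleton_subset_iff.2 (mem_of_mem_nhds hU)))
  rw [optimalScore_singleton_bot hμ, ENNReal.ofReal_pos]
  exact Real.exp_pos _

/-- Integrating the constant CDF over the gap of length `b - μ` yields exactly the value at which
the exponential antiderivative starts, so no constant of integration remains. -/
lemma lowerPartialMoment_optimalScore (hμ : μ ∈ Ioo a b) {s : ℝ} (hs : s ∈ Icc (a + b - μ) b) :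
    lowerPartialMoment (optimalScore hμ) s = (b - μ) * Real.exp ((s - b) / (b - μ)) := by
  have hmem := ae_mem_of_support_subset (support_optimalScore_subset hμ)
  have hi := lowerPartialMoment.integrable_of_ae_mem hmem
  have hΔ : 0 < b - μ := sub_pos.2 hμ.2
  have ha : a ≤ a + b - μ := by linarith
  have h1 := lowerPartialMoment.integral_cdf hi ha
  have h2 := lowerPartialMoment.integral_cdf hi hs.1
  have e1 : ∫ t in a..(a + b - μ), cdf (optimalScore hμ : Measure ℝ) t =
      ∫ _ in a..(a + b - μ), Real.exp ((a - μ) / (b - μ)) := by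
    refine intervalIntegral.integral_congr fun t ht => ?_
    rw [uIcc_of_le ha] at ht
    exact (cdf_optimalScore hμ t).trans (optimalCDF_of_mem_gap hμ ht)
  have e2 : ∫ t in (a + b - μ)..s, cdf (optimalScore hμ : Measure ℝ) t =
      ∫ t in (a + b - μ)..s, Real.exp ((t - b) / (b - μ)) := by
    refine intervalIntegral.integral_congr fun t ht => ?_
    rw [uIcc_of_le hs.1] at ht
    exact (cdf_optimalScore hμ t).trans (optimalCDF_of_mem_upper hμ ⟨ht.1, ht.2.trans hs.2⟩)
  have e3 : ∫ t in (a + b - μ)..s, Real.exp ((t - b) / (b - μ)) =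
      (b - μ) * Real.exp ((s - b) / (b - μ)) -
        (b - μ) * Real.exp ((a + b - μ - b) / (b - μ)) := by
    refine intervalIntegral.integral_eq_sub_of_hasDerivAt
      (f := fun t => (b - μ) * Real.exp ((t - b) / (b - μ))) (fun t _ => ?_)
      (Continuous.intervalIntegrable (by fun_prop) _ _)
    have h6 : HasDerivAt (fun y => (b - μ) * Real.exp ((y - b) / (b - μ)))
        ((b - μ) * (Real.exp ((t - b) / (b - μ)) * (1 / (b - μ)))) t :=
      ((((hasDerivAt_id t).sub_const b).div_const _).exp).const_mul _
    have h7 : (b - μ) * (Real.exp ((t - b) / (b - μ)) * (1 / (b - μ))) =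
        Real.exp ((t - b) / (b - μ)) := by field_simp
    rwa [h7] at h6
  rw [e1, intervalIntegral.integral_const, lowerPartialMoment.eq_zero_of_le hmem le_rfl,
    smul_eq_mul, sub_zero] at h1
  rw [e2, e3, ← h1] at h2
  have e4 : a + b - μ - b = a - μ := by ring
  have e5 : a + b - μ - a = b - μ := by ring
  rw [e4, e5] at h2
  linarith

/-- At `b` the lower partial moment is `b` minus the mean, and the exponential formula gives `b -
μ`. -/
lemma integral_optimalScore (hμ : μ ∈ Ioo a b) :
    ∫ s, s ∂(optimalScore hμ : Measure ℝ) = μ := by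
  have h1 := lowerPartialMoment_optimalScore hμ (s := b) ⟨by linarith [hμ.1], le_rfl⟩
  rw [lowerPartialMoment.eq_sub_of_ge
    (ae_mem_of_support_subset (support_optimalScore_subset hμ)) le_rfl, sub_self, zero_div,
    Real.exp_zero] at h1
  linarith

end OptimalScore

/-! ### Feasibility, optimality and uniqueness. -/

variable {F : ProbabilityMeasure ℝ} {a b : ℝ}

/-- The optimal test-fee structure. -/
noncomputable def optimalStructure {μ : ℝ} (hμ : μ ∈ Ioo a b) : TestFeeStructure :=
  ⟨optimalScore hμ, 0, b - μ⟩

lemma isFeasible_optimalStructure (hab : a < b) (hF : (F : Measure ℝ).support = {a, b})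
    (hμ : priorMean F ∈ Ioo a b) :
    IsFeasible F (optimalStructure hμ) (a + b - priorMean F) := by
  have hsupp := support_optimalScore_subset hμ
  have hmem := ae_mem_of_support_subset hsupp
  have hi := lowerPartialMoment.integrable_of_ae_mem hmem
  have hle : a + b - priorMean F ≤ b := by linarith [hμ.1]
  have hupper : ∀ y ∈ Icc (a + b - priorMean F) b,
      lowerPartialMoment (optimalScore hμ) y =
        (b - priorMean F) * cdf (optimalScore hμ : Measure ℝ) y := fun y hy => by
    rw [lowerPartialMoment_optimalScore hμ hy, cdf_optimalScore, optimalCDF_of_mem_upper hμ hy]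
  refine ⟨(isMeanPreservingContraction_iff hab hF).2 ⟨hsupp, integral_optimalScore hμ⟩, ?_,
    isWeakHighestThreshold_of_lowerPartialMoment hi
      ((lowestValue_optimalScore_le hμ).trans (by linarith [hμ.2])) ?_ (hupper _ ⟨le_rfl, hle⟩)
      fun y hy => ?_⟩
  · exact setIntegral_nonneg measurableSet_Icc fun s hs => sub_nonneg.2 hs.1
  · change 0 < cdf (optimalScore hμ : Measure ℝ) _
    rw [cdf_optimalScore, optimalCDF_of_mem_upper hμ ⟨le_rfl, hle⟩]
    exact Real.exp_pos _
  · change (b - priorMean F) * cdf (optimalScore hμ : Measure ℝ) y ≤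
      lowerPartialMoment (optimalScore hμ) y
    rcases le_total y b with h | h
    · exact (hupper y ⟨hy.le, h⟩).ge
    -- Beyond `b` the CDF stays at one while the moment keeps growing.
    · refine le_trans (le_of_eq ?_) (lowerPartialMoment.mono hi h)
      rw [hupper b ⟨hle, le_rfl⟩, lowerPartialMoment.cdf_eq_one_of_ge hmem h,
        lowerPartialMoment.cdf_eq_one_of_ge hmem le_rfl]

lemma revenue_optimalStructure {μ : ℝ} (hμ : μ ∈ Ioo a b) :
    revenue (optimalStructure hμ) (a + b - μ) =
      (b - μ) * (1 - Real.exp ((a - μ) / (b - μ))) := by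
  change 0 + (b - μ) * (1 - cdf (optimalScore hμ : Measure ℝ) _) = _
  rw [cdf_optimalScore, optimalCDF_of_mem_gap hμ ⟨by linarith [hμ.2], le_rfl⟩, zero_add]

lemma revenue_le (hab : a < b) (hF : (F : Measure ℝ).support = {a, b}) {x : TestFeeStructure}
    {τ : ℝ} (hx : IsFeasible F x τ) :
    revenue x τ ≤
      (b - priorMean F) * (1 - Real.exp ((a - priorMean F) / (b - priorMean F))) := by
  by_contra! h
  by_cases hd : x.disclosureFee = b - priorMean F
  · exact h.ne' (eq_of_le_revenue_of_disclosureFee_eq hab hF hx hd h.le).1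
  · exact (revenue_lt_of_disclosureFee_ne hab hF hx hd).not_gt h

lemma isRobustlyOptimal_iff (hab : a < b) (hF : (F : Measure ℝ).support = {a, b})
    (hμ : priorMean F ∈ Ioo a b) (y : TestFeeStructure) :
    IsRobustlyOptimal F y ↔ y = optimalStructure hμ := by
  constructor
  · rintro ⟨τ, hy, hmax⟩
    have hR := hmax _ _ (isFeasible_optimalStructure hab hF hμ)
    rw [revenue_optimalStructure] at hR
    have hd : y.disclosureFee = b - priorMean F := by
      by_contra hd
      exact (revenue_lt_of_disclosureFee_ne hab hF hy hd).not_ge hR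
    obtain ⟨-, ht, hcdf⟩ := eq_of_le_revenue_of_disclosureFee_eq hab hF hy hd hR
    refine TestFeeStructure.ext (Subtype.ext ?_) ht hd
    exact Measure.eq_of_cdf (y.score : Measure ℝ) (optimalScore hμ : Measure ℝ)
      (StieltjesFunction.ext fun s => (hcdf s).trans (cdf_optimalScore hμ s).symm)
  · rintro rfl
    refine ⟨_, isFeasible_optimalStructure hab hF hμ, fun x' τ' hx' => ?_⟩
    rw [revenue_optimalStructure]
    exact revenue_le hab hF hx'

end TestFee

theorem proposition3 (F : ProbabilityMeasure ℝ) (θlo θhi μ : ℝ)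
    (h_nonneg : 0 ≤ θlo) (h_lt : θlo < θhi)
    (h_support : (F : Measure ℝ).support = {θlo, θhi})
    (h_mean : μ = TestFee.priorMean F) :
    ∃ x : TestFee.TestFeeStructure,
      -- `x` is the unique robustly optimal test-fee structure
      (∀ y : TestFee.TestFeeStructure, TestFee.IsRobustlyOptimal F y ↔ y = x) ∧
      -- the fees
      x.testingFee = 0 ∧ x.disclosureFee = θhi - μ ∧ 0 < x.disclosureFee ∧
      -- the CDF of the scores
      (∀ s ∈ Set.Iio θlo, cdf (x.score : Measure ℝ) s = 0) ∧
      (∀ s ∈ Set.Ico θlo (θlo + θhi - μ),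
        cdf (x.score : Measure ℝ) s = Real.exp ((θlo - μ) / (θhi - μ))) ∧
      (∀ s ∈ Set.Icc (θlo + θhi - μ) θhi,
        cdf (x.score : Measure ℝ) s = Real.exp ((s - θhi) / (θhi - μ))) ∧
      -- the lowest value is an atom, there is a gap above it, and there is no atom at the top
      (x.score : Measure ℝ) {θlo} = ENNReal.ofReal (Real.exp ((θlo - μ) / (θhi - μ))) ∧
      θlo < θlo + θhi - μ ∧ (x.score : Measure ℝ) (Set.Ioo θlo (θlo + θhi - μ)) = 0 ∧
      (x.score : Measure ℝ) {θhi} = 0 := by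
  subst h_mean
  have hμ := TestFee.priorMean_mem_Ioo h_lt h_support
  refine ⟨TestFee.optimalStructure hμ, TestFee.isRobustlyOptimal_iff h_lt h_support hμ, rfl, rfl,
    sub_pos.2 hμ.2, fun s hs => ?_, fun s hs => ?_, fun s hs => ?_,
    TestFee.optimalScore_singleton_bot hμ, by linarith [hμ.2], TestFee.optimalScore_gap hμ,
    TestFee.optimalScore_singleton_top hμ⟩
  · exact (TestFee.cdf_optimalScore hμ s).trans (TestFee.optimalCDF_of_lt hs)
  · exact (TestFee.cdf_optimalScore hμ s).trans
      (TestFee.optimalCDF_of_mem_gap hμ ⟨hs.1, hs.2.le⟩)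
  · exact (TestFee.cdf_optimalScore hμ s).trans (TestFee.optimalCDF_of_mem_upper hμ hs)
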